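/- Let $n\ge 3$ and $k\ge 1$ be integers. A width 2 simple permutation of $\{0,1\}^n$ is a map $f_{i,J,h}$ given by $i\in\{1,\dots,n\}$, an ordered pair $J=(j_1,j_2)$ of distinct elements of $\{1,\dots,n\}\setminus\{i\}$ and a Boolean function $h:\{0,1\}^2\to\{0,1\}$; it replaces the $i$-th coordinate $x_i$ of $x\in\{0,1\}^n$ by $x_i\oplus h(x_{j_1},x_{j_2})$ and leaves the other coordinates unchanged. Let $P=P_{n,k}$ be the transition matrix of the random walk on the set of $k$-tuples of distinct elements of $\{0,1\}^n$ which in each step picks one of the $16n(n-1)(n-2)$ triples $(i,J,h)$ uniformly at random and applies $f_{i,J,h}$ to each of the $k$ entries of the current tuple. The matrix $P$ is symmetric; let $1=\beta_0\ge\beta_1\ge\cdots$ be its eigenvalues, listed with multiplicity, and let $\mathrm{gap}(P)=1-\beta_1$. Then $1/\mathrm{gap}(P)=O(n^2k)$ for $k\le 2^n/3$; that is, there is an absolute constant $C>0$ such that for all integers $n\ge 3$ and $1\le k\le 2^n/3$ we have $\mathrm{gap}(P_{n,k})>0$ and $$\frac{1}{\mathrm{gap}(P_{n,k})}\le C\,n^2k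 .$$ -/

import Mathlib

/-- The binary cube `{0,1}^n`. -/
abbrev Cube (n : ℕ) : Type := Fin n → Bool

/-- The labels `(i, J, h)` of the width `w` simple permutations of `{0,1}^n`: a coordinate `i`,
an ordered choice `J` of `w` distinct coordinates different from `i`, and a Boolean function `h`
of `w` bits. For `w = 2` there are `16 n (n-1) (n-2)` of them. -/
abbrev SimpleLabel (w n : ℕ) : Type :=
  Σ i : Fin n, (Fin w ↪ {j : Fin n // j ≠ i}) × ((Fin w → Bool) → Bool)

/-- The map `f_{i,J,h}`: replace `x_i` by `x_i ⊕ h(x_{j_1}, …, x_{j_w})`. -/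
def simpleFun {w n : ℕ} (s : SimpleLabel w n) (x : Cube n) : Cube n :=
  Function.update x s.1 (xor (x s.1) (s.2.2 fun t => x (s.2.1 t)))

theorem simpleFun_involutive {w n : ℕ} (s : SimpleLabel w n) :
    Function.Involutive (simpleFun s) := by
  intro x
  have hJ : ∀ t, simpleFun s x (s.2.1 t) = x (s.2.1 t) := fun t =>
    Function.update_of_ne (s.2.1 t).2 _ _
  have hi : simpleFun s x s.1 = xor (x s.1) (s.2.2 fun t => x (s.2.1 t)) :=
    Function.update_self _ _ _
  funext j
  by_cases hj : j = s.1
  · subst hj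
    rw [simpleFun, Function.update_self, hi]
    simp only [hJ, Bool.xor_assoc, Bool.xor_self, Bool.xor_false]
  · rw [simpleFun, Function.update_of_ne hj, simpleFun, Function.update_of_ne hj]

/-- The simple permutation `f_{i,J,h}` of the cube. -/
def simplePerm {w n : ℕ} (s : SimpleLabel w n) : Equiv.Perm (Cube n) :=
  (simpleFun_involutive s).toPerm

/-- The `k`-tuples of distinct elements of `{0,1}^n`. -/
abbrev DistinctTuple (n k : ℕ) : Type := Fin k ↪ Cube n

/-- A simple permutation acts on a tuple by acting on each of its entries. -/
def simpleAct {w n k : ℕ} (s : SimpleLabel w n) (x : DistinctTuple n k) : DistinctTuple n k :=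
  x.trans (simplePerm s).toEmbedding

theorem simpleAct_involutive {w n k : ℕ} (s : SimpleLabel w n) :
    Function.Involutive (simpleAct (k := k) s) := by
  intro x
  ext1 r
  exact simpleFun_involutive s (x r)

/-- Transition matrix of the random walk on `k`-tuples of distinct elements of `{0,1}^n` which in
each step picks a uniformly random label `(i, J, h)` of width `2` and applies `f_{i,J,h}` to
every entry of the current tuple. -/
noncomputable def walkMatrix (n k : ℕ) : Matrix (DistinctTuple n k) (DistinctTuple n k) ℝ :=
  Matrix.of fun x y =>
    ((Finset.univ.filter fun s : SimpleLabel 2 n => simpleAct s x = y).card : ℝ) /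
      (Fintype.card (SimpleLabel 2 n) : ℝ)

theorem walkMatrix_isHermitian (n k : ℕ) : (walkMatrix n k).IsHermitian := by
  refine Matrix.IsHermitian.ext fun x y => ?_
  have h : ∀ s : SimpleLabel 2 n, simpleAct s y = x ↔ simpleAct s x = y := fun s =>
    ⟨fun h => by rw [← h, simpleAct_involutive s y], fun h => by rw [← h, simpleAct_involutive s x]⟩
  simp only [walkMatrix, Matrix.of_apply, h, star_trivial]

/-- The spectral gap `1 - β₁` of a symmetric transition matrix with at least two states, where
`β₀ ≥ β₁ ≥ …` are its eigenvalues, listed with multiplicity in nonincreasing order. -/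
noncomputable def spectralGap {V : Type*} [Fintype V] [DecidableEq V] (A : Matrix V V ℝ)
    (hA : A.IsHermitian) (hV : 1 < Fintype.card V) : ℝ :=
  1 - hA.eigenvalues₀ ⟨1, hV⟩

theorem one_lt_card_distinctTuple {n k : ℕ} (hn : 3 ≤ n) (hk : 1 ≤ k)
    (hkn : (k : ℝ) ≤ 2 ^ n / 3) : 1 < Fintype.card (DistinctTuple n k) := by
  have h3 : 3 * k ≤ 2 ^ n := by
    have : (3 : ℝ) * k ≤ 2 ^ n := by linarith
    exact_mod_cast this
  have h8 : 2 ^ 3 ≤ 2 ^ n := Nat.pow_le_pow_right (by norm_num) hn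
  have hc : Fintype.card (Cube n) = 2 ^ n := by simp [Cube]
  rw [Fintype.card_embedding_eq, hc, Fintype.card_fin]
  have h1 : 1 < 2 ^ n + 1 - k := by omega
  have h2 : 2 ^ n + 1 - k ≤ (2 ^ n + 1 - k) ^ k := Nat.le_self_pow (by omega) _
  exact lt_of_lt_of_le h1 (h2.trans (Nat.pow_sub_le_descFactorial _ _))

/-! The walk is compared, through Dirichlet forms, with a swap chain on the same tuples, which picks
an entry `x r` and a value `c` and exchanges these two values. Write N = 2^n. The swap chain has an
explicit gap. A nonconstant eigenvector of its unnormalized Laplacian is tested in a weighted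
Lipschitz metric on transpositions of values; a synchronous coupling contracts this metric, so the
eigenvalue is at least N - 2k (`le_eigenvalue_swapLaplacian`). Each swap is then simulated by gates.
A circuit of O(n) gates without spare wires exchanges a and b, but may also disturb c and a + b + c
for an auxiliary point c (`planeSwap`). This is harmless when neither point lies in the tuple, which
holds for at least N - 2k choices of c. Congestion is controlled by symmetry: conjugating by
coordinate permutations and translations of the cube sends gates to gates and leaves the swap energy
invariant, and averaging over them spreads each step of a word evenly over all wires and tuples.
Cauchy–Schwarz along the paths costs a factor L^2 with L = 22n (`swapEnergy_le_simpleEnergy`). As k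
≤ N/3, both factors N - 2k are at least N/3, and the powers of N cancel. -/

/-! ### Words of gates. -/

/-- The result of applying the simple permutations of the word `w`, from left to right, to `x`. -/
def wordAct {n : ℕ} (w : List (SimpleLabel 2 n)) (x : Cube n) : Cube n :=
  w.foldl (fun y s => simpleFun s y) x

/-- `π` is a composition of at most `L` simple permutations of width `2`. -/
def Realizes {n : ℕ} (L : ℕ) (π : Cube n → Cube n) : Prop :=
  ∃ w : List (SimpleLabel 2 n), w.length ≤ L ∧ ∀ x, wordAct w x = π x

theorem Realizes.mono {n L L' : ℕ} {π : Cube n → Cube n} (h : Realizes L π) (hL : L ≤ L') :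
    Realizes L' π := by
  obtain ⟨w, hw, h⟩ := h
  exact ⟨w, hw.trans hL, h⟩

theorem Realizes.comp {n L L' : ℕ} {π π' : Cube n → Cube n} (h : Realizes L π)
    (h' : Realizes L' π') : Realizes (L + L') (fun x => π' (π x)) := by
  obtain ⟨w, hw, h⟩ := h
  obtain ⟨w', hw', h'⟩ := h'
  refine ⟨w ++ w', by simp; omega, fun x => ?_⟩
  change wordAct (w ++ w') x = π' (π x)
  rw [← h, ← h', wordAct, List.foldl_append]
  rfl

theorem Realizes.congr {n L : ℕ} {π π' : Cube n → Cube n} (h : Realizes L π)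
    (hπ : ∀ x, π x = π' x) : Realizes L π' := by
  obtain ⟨w, hw, h⟩ := h
  exact ⟨w, hw, fun x => (h x).trans (hπ x)⟩

theorem realizes_id {n : ℕ} : Realizes 0 (fun x : Cube n => x) := ⟨[], le_rfl, fun _ => rfl⟩

/-- Add the bit `φ x` to the coordinate `t` of `x`. -/
def flipAt {n : ℕ} (t : Fin n) (φ : Cube n → Bool) (x : Cube n) : Cube n :=
  Function.update x t (xor (x t) (φ x))

theorem flipAt_apply {n : ℕ} (t : Fin n) (φ : Cube n → Bool) (x : Cube n) (l : Fin n) :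
    flipAt t φ x l = xor (x l) (decide (l = t) && φ x) := by
  by_cases h : l = t
  · subst h; simp [flipAt]
  · simp [flipAt, h]

theorem realizes_gate {n : ℕ} {t p q : Fin n} (hp : p ≠ t) (hq : q ≠ t) (hpq : p ≠ q)
    (h : Bool → Bool → Bool) : Realizes 1 (flipAt t fun x => h (x p) (x q)) := by
  let J : Fin 2 ↪ {j : Fin n // j ≠ t} :=
    ⟨![⟨p, hp⟩, ⟨q, hq⟩], by
      intro a b hab
      fin_cases a <;> fin_cases b <;> simp_all [Subtype.ext_iff]⟩
  exact ⟨[⟨t, J, fun y => h (y 0) (y 1)⟩], le_rfl, fun x => rfl⟩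

/-- Gates always read two distinct wires, so a gate depending on fewer bits needs a dummy input; n ≥
3 supplies it. -/
theorem exists_third {n : ℕ} (hn : 3 ≤ n) (t p : Fin n) : ∃ q, q ≠ t ∧ p ≠ q := by
  have : ({t, p} : Finset (Fin n)).card < (Finset.univ : Finset (Fin n)).card := by
    have := Finset.card_le_two (a := t) (b := p)
    simp; omega
  obtain ⟨q, -, hq⟩ := Finset.exists_mem_notMem_of_card_lt_card this
  simp only [Finset.mem_insert, Finset.mem_singleton, not_or] at hq
  exact ⟨q, hq.1, Ne.symm hq.2⟩

theorem realizes_gate_one {n : ℕ} (hn : 3 ≤ n) {t p : Fin n} (hp : p ≠ t) (h : Bool → Bool) :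
    Realizes 1 (flipAt t fun x => h (x p)) := by
  obtain ⟨q, hq, hpq⟩ := exists_third hn t p
  exact realizes_gate hp hq hpq fun a _ => h a

theorem realizes_gate_const {n : ℕ} (hn : 3 ≤ n) (t : Fin n) (b : Bool) :
    Realizes 1 (flipAt t fun _ => b) := by
  obtain ⟨p, hp, -⟩ := exists_third hn t t
  exact realizes_gate_one hn hp fun _ => b

/-- Adding the same bit to all coordinates in `T`. -/
theorem realizes_fan {n : ℕ} (φ : Cube n → Bool) (T : Finset (Fin n))
    (h1 : ∀ l ∈ T, Realizes 1 (flipAt l φ)) (h2 : ∀ l ∈ T, ∀ x, φ (flipAt l φ x) = φ x) :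
    Realizes T.card (fun x l => xor (x l) (decide (l ∈ T) && φ x)) := by
  induction T using Finset.induction_on with
  | empty => exact realizes_id.congr fun x => by simp
  | insert t T ht ih =>
    rw [Finset.card_insert_of_notMem ht, add_comm]
    refine ((h1 t (Finset.mem_insert_self _ _)).comp
      (ih (fun l hl => h1 l (Finset.mem_insert_of_mem hl))
        fun l hl => h2 l (Finset.mem_insert_of_mem hl))).congr fun x => ?_
    funext l
    rw [h2 t (Finset.mem_insert_self _ _), flipAt_apply]
    by_cases hl : l = t
    · subst hl; simp [ht]
    · simp [hl]

/-! ### Multiply controlled negations with borrowed bits. -/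

/-- All coordinates in `C` are set. -/
def allSet {n : ℕ} (C : Finset (Fin n)) (x : Cube n) : Bool := decide (∀ c ∈ C, x c = true)

theorem allSet_insert {n : ℕ} (C : Finset (Fin n)) (c : Fin n) (x : Cube n) :
    allSet (insert c C) x = (x c && allSet C x) := by
  simp [allSet]

theorem allSet_congr {n : ℕ} {C : Finset (Fin n)} {x y : Cube n} (h : ∀ c ∈ C, x c = y c) :
    allSet C x = allSet C y := by
  simp only [allSet]
  congr 1
  exact propext (forall₂_congr fun c hc => by rw [h c hc])

/-- The conjunction of the bits in `C` can be added to a bit `d ∉ D`, while the bits in `D` change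
by functions of the bits in `C`; the second map performs only the changes in `D`. -/
theorem exists_ladder {n : ℕ} (m : ℕ) : ∀ (C D : Finset (Fin n)) (d : Fin n), C.card = m + 2 →
    D.card = m → Disjoint C D → d ∉ C → d ∉ D →
    ∃ φ : Cube n → Cube n, (∀ x l, l ∉ D → φ x l = false) ∧
      (∀ x y, (∀ c ∈ C, x c = y c) → φ x = φ y) ∧
      Realizes (2 * m) (fun x l => xor (x l) (φ x l)) ∧
      Realizes (2 * m + 1) (fun x l => xor (x l) (xor (φ x l) (decide (l = d) && allSet C x))) := by
  induction m with
  | zero =>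
    intro C D d hC hD _ hdC _
    obtain ⟨p, q, hpq, rfl⟩ := Finset.card_eq_two.1 hC
    refine ⟨fun _ _ => false, fun _ _ _ => rfl, fun _ _ _ => rfl,
      realizes_id.congr fun x => by simp, ?_⟩
    simp only [Finset.mem_insert, Finset.mem_singleton, not_or] at hdC
    refine (realizes_gate (Ne.symm hdC.1) (Ne.symm hdC.2) hpq fun a b => a && b).congr fun x => ?_
    funext l
    rw [flipAt_apply]
    simp [allSet]
  | succ m ih =>
    intro C D d hC hD hCD hdC hdD
    obtain ⟨c, C, hc, rfl, hC'⟩ := Finset.card_eq_succ.1 hC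
    obtain ⟨e, D, he, rfl, hD'⟩ := Finset.card_eq_succ.1 hD
    simp only [Finset.disjoint_insert_left, Finset.disjoint_insert_right, Finset.mem_insert,
      not_or] at hCD hdC hdD
    obtain ⟨φ, h1, h2, h3, h4⟩ := ih C D e hC' hD' hCD.2.2 hCD.1.2 he
    have hφ : ∀ x y : Cube n, (∀ b ∈ C, x b = y b) →
      (fun l => xor (φ x l) (decide (l = e) && allSet C x)) =
        fun l => xor (φ y l) (decide (l = e) && allSet C y) := fun x y hxy => by
      rw [h2 x y hxy, allSet_congr hxy]
    -- The new disturbance is the full map of the smaller instance with target `e`, so `h4` already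
    -- realizes it.
    refine ⟨fun x l => xor (φ x l) (decide (l = e) && allSet C x), ?_, ?_, h4.mono (by omega), ?_⟩
    · intro x l hl
      simp only [Finset.mem_insert, not_or] at hl
      simp [h1 x l hl.2, hl.1]
    · exact fun x y hxy => hφ x y fun b hb => hxy b (Finset.mem_insert_of_mem hb)
    · have hg := realizes_gate (n := n) (t := d) (p := c) (q := e) (Ne.symm hdC.1)
        (Ne.symm hdD.1) (Ne.symm hCD.1.1) fun a b => a && b
      -- Adding `x c && x e` to `d` before and after `e` is toggled by the conjunction of `C`
      -- cancels the unknown old value of `e` and leaves the conjunction of `insert c C`.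
      refine ((hg.comp h4).comp hg).mono (by omega) |>.congr fun x => ?_
      have key := fun l => congrFun (hφ (flipAt d (fun x => x c && x e) x) x fun b hb => by
        rw [flipAt_apply]
        have : b ≠ d := fun h => hdC.2 (h ▸ hb)
        simp [this]) l
      have hce : c ≠ e := Ne.symm hCD.1.1
      have hcd : c ≠ d := Ne.symm hdC.1
      have hed : e ≠ d := Ne.symm hdD.1
      have hcD : c ∉ D := hCD.2.1
      have ka : allSet C (flipAt d (fun x => x c && x e) x) = allSet C x := by
        simpa [h1 _ e he] using key e
      have hx : ∀ y l, l ≠ d → flipAt d (fun x => x c && x e) y l = y l := fun y l h => by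
        simp [flipAt_apply, h]
      have hd : ∀ y : Cube n, flipAt d (fun x => x c && x e) y d = xor (y d) (y c && y e) :=
        fun y => by simp [flipAt_apply]
      funext l
      rw [flipAt_apply]
      simp only [key, allSet_insert]
      by_cases hl : l = d
      · subst hl
        have hle := Ne.symm hed
        simp only [hx _ _ hcd, hx _ _ hed, hd, h1 _ c hcD, h1 _ e he, h1 _ l hdD.2, ka, hce, hle,
          decide_true, decide_false, Bool.true_and, Bool.false_and, Bool.false_xor, Bool.xor_false]
        cases x c <;> cases x e <;> cases x l <;> cases allSet C x <;> rfl
      · simp [hl, hx]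

/-- A negation controlled by the bits in `C`, with the bits in `D` as uninitialized scratch space. -/
theorem realizes_flipAt_allSet {n : ℕ} (hn : 3 ≤ n) {C D : Finset (Fin n)} {t : Fin n}
    (hC : C.Nonempty) (hCD : Disjoint C D) (htC : t ∉ C) (htD : t ∉ D)
    (hcard : C.card ≤ D.card + 2) : Realizes (4 * C.card) (flipAt t (allSet C)) := by
  have hpos := hC.card_pos
  by_cases h1 : C.card = 1
  · obtain ⟨p, rfl⟩ := Finset.card_eq_one.1 h1
    have hp : p ≠ t := fun h => htC (by simp [h])
    refine ((realizes_gate_one hn hp id).congr fun x => ?_).mono (by simp)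
    simp [flipAt, allSet]
  · obtain ⟨m, hm⟩ : ∃ m, C.card = m + 2 := ⟨C.card - 2, by omega⟩
    obtain ⟨D', hD', hm'⟩ := Finset.exists_subset_card_eq (s := D) (n := m) (by omega)
    have hCD' := Finset.disjoint_of_subset_right hD' hCD
    obtain ⟨φ, h1, h2, h3, h4⟩ := exists_ladder m C D' t hm hm' hCD' htC
      fun h => htD (hD' h)
    -- `φ` depends only on the bits of `C`, which are unchanged, so the second map undoes the
    -- changes to the scratch bits.
    refine (h4.comp h3).mono (by omega) |>.congr fun x => ?_
    have e := h2 (fun l => xor (x l) (xor (φ x l) (decide (l = t) && allSet C x))) x ?_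
    · funext l
      rw [flipAt_apply, e]
      dsimp only
      cases x l <;> cases φ x l <;> cases (decide (l = t) && allSet C x) <;> rfl
    · intro c hc
      have hct : c ≠ t := fun h => htC (h ▸ hc)
      simp [h1 x c (Finset.disjoint_left.1 hCD' hc), hct]

/-- A negation of bit `i` controlled by all bits except `i` and `j`. -/
theorem realizes_flipAt_allSet_compl {n : ℕ} (hn : 3 ≤ n) {i j : Fin n} (hij : i ≠ j) :
    Realizes (16 * n) (flipAt i (allSet (Finset.univ \ {i, j}))) := by
  set U : Finset (Fin n) := Finset.univ \ {i, j} with hU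
  have hUcard : U.card = n - 2 := by
    rw [hU, Finset.card_sdiff_of_subset (Finset.subset_univ _), Finset.card_pair hij]; simp
  -- The controls are halved so that each half can serve as scratch space for the other; `A` is
  -- nonempty because n ≥ 3.
  obtain ⟨A, hAU, hA⟩ := Finset.exists_subset_card_eq (s := U) (n := (n - 1) / 2) (by omega)
  set B := U \ A with hB
  have hBcard : B.card = (n - 2) - (n - 1) / 2 := by
    rw [hB, Finset.card_sdiff_of_subset hAU, hUcard, hA]
  have hiU : i ∉ U := by simp [hU]
  have hjU : j ∉ U := by simp [hU]
  have hiA : i ∉ A := fun h => hiU (hAU h)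
  have hjA : j ∉ A := fun h => hjU (hAU h)
  have hiB : i ∉ B := fun h => hiU (Finset.sdiff_subset h)
  have hjB : j ∉ B := fun h => hjU (Finset.sdiff_subset h)
  have hAB : Disjoint A B := Finset.disjoint_sdiff
  have g1 : Realizes (4 * n) (flipAt j (allSet A)) := by
    refine (realizes_flipAt_allSet hn (D := insert i B) (Finset.card_pos.1 (by omega))
      (by simp [hiA, hAB]) hjA (by simp [hjB, Ne.symm hij]) ?_).mono (by omega)
    rw [Finset.card_insert_of_notMem hiB]; omega
  have g2 : Realizes (4 * n) (flipAt i (allSet (insert j B))) := by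
    refine (realizes_flipAt_allSet hn (D := A) (Finset.insert_nonempty _ _)
      (by simp [hjA, hAB.symm]) (by simp [hiB, hij]) hiA ?_).mono ?_
    all_goals rw [Finset.card_insert_of_notMem hjB]; omega
  -- A commutator: bit `i` is flipped twice under control of `B` and `j`, with `j` differing by the
  -- conjunction of `A`; bit `j` is restored.
  refine (((g1.comp g2).comp g1).comp g2).mono (by omega) |>.congr fun x => ?_
  have hUAB : U = A ∪ B := by rw [hB, Finset.union_sdiff_of_subset hAU]
  have hall : allSet U x = (allSet A x && allSet B x) := by
    rw [hUAB]
    simp [allSet, or_imp, forall_and]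
  have eA : ∀ y z : Cube n, (∀ l, l ≠ i → l ≠ j → y l = z l) → allSet A y = allSet A z :=
    fun y z h => allSet_congr fun c hc => h c (fun e => hiA (e ▸ hc)) (fun e => hjA (e ▸ hc))
  have eB : ∀ y z : Cube n, (∀ l, l ≠ i → l ≠ j → y l = z l) → allSet B y = allSet B z :=
    fun y z h => allSet_congr fun c hc => h c (fun e => hiB (e ▸ hc)) (fun e => hjB (e ▸ hc))
  have hi : ∀ φ (y : Cube n) l, l ≠ i → flipAt i φ y l = y l := fun φ y l h => by
    simp [flipAt_apply, h]
  have hj : ∀ φ (y : Cube n) l, l ≠ j → flipAt j φ y l = y l := fun φ y l h => by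
    simp [flipAt_apply, h]
  set x1 := flipAt j (allSet A) x with hx1
  set x2 := flipAt i (allSet (insert j B)) x1 with hx2
  set x3 := flipAt j (allSet A) x2 with hx3
  have e1 : ∀ l, l ≠ i → l ≠ j → x1 l = x l := fun l _ h => hj _ _ _ h
  have e2 : ∀ l, l ≠ i → l ≠ j → x2 l = x l := fun l h h' => (hi _ _ _ h).trans (e1 l h h')
  have e3 : ∀ l, l ≠ i → l ≠ j → x3 l = x l := fun l h h' => (hj _ _ _ h').trans (e2 l h h')
  have a2 := eA x2 x e2
  have b1 := eB x1 x e1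
  have b3 := eB x3 x e3
  have hji : j ≠ i := hij.symm
  have x1j : x1 j = xor (x j) (allSet A x) := by simp [hx1, flipAt_apply]
  have x2j : x2 j = x1 j := hi _ _ _ hji
  have x3j : x3 j = x j := by
    rw [hx3, flipAt_apply, x2j, x1j, a2]; simp
  have x3i : x3 i = xor (x i) (x1 j && allSet B x) := by
    rw [hx3, hj _ _ _ hij, hx2, flipAt_apply, allSet_insert, b1, hx1, hj _ _ _ hij]; simp
  funext l
  rw [flipAt_apply, flipAt_apply, allSet_insert, b3, hall, x3j]
  by_cases hl : l = i
  · subst hl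
    rw [x3i, x1j]
    cases x l <;> cases x j <;> cases allSet A x <;> cases allSet B x <;> simp
  · by_cases hl' : l = j
    · subst hl'; simp [hl, x3j]
    · simp [hl, e3 l hl hl']

/-! ### Exchanging two points within an affine plane. -/

/-- The coordinatewise sum of three points of the cube. -/
def xor3 {n : ℕ} (a b c : Cube n) : Cube n := fun l => xor (xor (a l) (b l)) (c l)

/-- Some word of length at most `L` exchanges `a` and `b` and fixes all points outside the plane
spanned by `a`, `b` and `c`. -/
def PlaneSwap {n : ℕ} (L : ℕ) (a b c : Cube n) : Prop :=
  ∃ w : List (SimpleLabel 2 n), w.length ≤ L ∧ wordAct w a = b ∧ wordAct w b = a ∧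
    ∀ p, p ≠ a → p ≠ b → p ≠ c → p ≠ xor3 a b c → wordAct w p = p

/-- Conjugation by an affine involution: compatibility with `xor3` sends the fourth point of the
plane to the fourth point, and one word for `γ` serves on both sides. -/
theorem PlaneSwap.conj {n L m : ℕ} {a b c : Cube n} {γ : Cube n → Cube n}
    (h : PlaneSwap L (γ a) (γ b) (γ c)) (hγ : Realizes m γ) (hinv : ∀ x, γ (γ x) = x)
    (h3 : ∀ x y z, γ (xor3 x y z) = xor3 (γ x) (γ y) (γ z)) : PlaneSwap (L + 2 * m) a b c := by
  obtain ⟨w, hw, h⟩ := h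
  obtain ⟨v, hv, hv'⟩ := hγ
  have key : ∀ x, wordAct (v ++ w ++ v) x = γ (wordAct w (γ x)) := fun x => by
    rw [← hv', ← hv']; simp [wordAct, List.foldl_append]
  refine ⟨v ++ w ++ v, by simp; omega, ?_, ?_, ?_⟩
  · rw [key, h.1, hinv]
  · rw [key, h.2.1, hinv]
  · intro p ha hb hc hd
    have inj : ∀ q, p ≠ q → γ p ≠ γ q := fun q hq e => hq (by rw [← hinv p, e, hinv])
    rw [key, h.2.2 _ (inj _ ha) (inj _ hb) (inj _ hc) (h3 a b c ▸ inj _ hd), hinv]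

/-- Negating bit `i` under control of all bits but `i` and `j` moves only the four points whose
other bits are all set, and these form the plane. -/
theorem planeSwap_unit {n : ℕ} (hn : 3 ≤ n) {i j : Fin n} (hij : i ≠ j) :
    PlaneSwap (16 * n) (fun _ => true) (fun l : Fin n => !decide (l = i))
      (fun l => !decide (l = j)) := by
  obtain ⟨w, hw, h⟩ := realizes_flipAt_allSet_compl hn hij
  refine ⟨w, hw, ?_, ?_, ?_⟩
  · rw [h]; funext l; rw [flipAt_apply]; simp [allSet]
  · rw [h]; funext l; rw [flipAt_apply]; simp [allSet]
    tauto
  · intro p h1 h2 h3 h4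
    rw [h]
    funext l
    rw [flipAt_apply]
    suffices allSet (Finset.univ \ {i, j}) p = false by simp [this]
    simp only [allSet, decide_eq_false_iff_not]
    intro hall
    have hall' : ∀ l, l ≠ i → l ≠ j → p l = true := fun l hi hj => hall l (by simp [hi, hj])
    have hext : ∀ q : Cube n, (∀ l, l ≠ i → l ≠ j → q l = true) → p i = q i → p j = q j → p = q :=
      fun q hq hi hj => by
        funext l
        by_cases e : l = i
        · rw [e, hi]
        · by_cases e' : l = j
          · rw [e', hj]
          · rw [hall' l e e', hq l e e']
    have hji := hij.symm
    cases hi : p i <;> cases hj : p j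
    · exact h4 (hext _ (fun l e e' => by simp [xor3, e, e']) (by simp [xor3, hi, hij])
        (by simp [xor3, hj, hji]))
    · exact h2 (hext _ (fun l e e' => by simp [e]) (by simp [hi]) (by simp [hj, hji]))
    · exact h3 (hext _ (fun l e e' => by simp [e']) (by simp [hi, hij]) (by simp [hj]))
    · exact h1 (hext _ (fun l e e' => by simp) (by simp [hi]) (by simp [hj]))

/-- Adding the complement of bit `i` to the bits in `T`. -/
def shear {n : ℕ} (i : Fin n) (T : Finset (Fin n)) (x : Cube n) : Cube n :=
  fun l => xor (x l) (decide (l ∈ T) && !x i)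

theorem realizes_shear {n : ℕ} (hn : 3 ≤ n) {i : Fin n} {T : Finset (Fin n)} (hi : i ∉ T) :
    Realizes n (shear i T) := by
  have hne : ∀ l ∈ T, i ≠ l := fun l hl e => hi (e ▸ hl)
  refine (realizes_fan (fun x => !x i) T (fun l hl => realizes_gate_one hn (hne l hl) (!·))
    fun l hl x => ?_).mono (by simpa using Finset.card_le_univ T)
  simp [flipAt_apply, hne l hl]

theorem shear_shear {n : ℕ} {i : Fin n} {T : Finset (Fin n)} (hi : i ∉ T) (x : Cube n) :
    shear i T (shear i T x) = x := by
  funext l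
  simp [shear, hi]

theorem shear_xor3 {n : ℕ} (i : Fin n) (T : Finset (Fin n)) (x y z : Cube n) :
    shear i T (xor3 x y z) = xor3 (shear i T x) (shear i T y) (shear i T z) := by
  funext l
  simp only [shear, xor3]
  cases decide (l ∈ T) <;> cases x i <;> cases y i <;> cases z i <;> cases x l <;> cases y l <;>
    cases z l <;> rfl

theorem shear_of_set {n : ℕ} {i : Fin n} (T : Finset (Fin n)) {x : Cube n} (h : x i = true) :
    shear i T x = x := by
  funext l; simp [shear, h]

/-- A shear which clears all bits but one of the complement of `b`. -/
theorem shear_filter {n : ℕ} {i : Fin n} {b : Cube n} (hb : b i = false) :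
    shear i (Finset.univ.filter fun l => l ≠ i ∧ b l = false) b = fun l => !decide (l = i) := by
  funext l
  by_cases h : l = i
  · subst h; simp [shear, hb]
  · cases e : b l <;> simp [shear, hb, h, e]

/-- Two shears, both fixing the all-ones point, reduce to the unit plane: the first brings `b` to
the point whose only zero is at `i`, the second does the same for the image of `c` at `j` without
moving the image of `b`. -/
theorem planeSwap_of_fst_true {n : ℕ} (hn : 3 ≤ n) {b c : Cube n} (hb : b ≠ fun _ => true)
    (hc : c ≠ fun _ => true) (hbc : c ≠ b) : PlaneSwap (20 * n) (fun _ => true) b c := by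
  have hex : ∀ {y : Cube n}, (y ≠ fun _ => true) → ∃ i, y i = false := fun {y} hy => by
    by_contra! h
    exact hy (funext fun i => by simpa using h i)
  obtain ⟨i, hi⟩ := hex hb
  set T := Finset.univ.filter fun l => l ≠ i ∧ b l = false with hT
  have hiT : i ∉ T := by simp [hT]
  set c' := shear i T c with hc'
  have hinj : ∀ x y, shear i T x = shear i T y → x = y := fun x y h => by
    rw [← shear_shear hiT x, h, shear_shear hiT]
  have hb' : shear i T b = fun l => !decide (l = i) := shear_filter hi
  have h1 : shear i T (fun _ => true) = fun _ => true := shear_of_set T rfl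
  have hc1 : c' ≠ fun _ => true := fun h => hc (hinj _ _ (h.trans h1.symm))
  have hc2 : c' ≠ fun l => !decide (l = i) := fun h => hbc (hinj _ _ (h.trans hb'.symm))
  -- If `c'` had no zero outside `i`, it would be the all-ones point or the image of `b`.
  obtain ⟨j, hji, hj⟩ : ∃ j, j ≠ i ∧ c' j = false := by
    by_contra! h
    obtain ⟨j, hj⟩ := hex hc1
    have hjj : j = i := by
      by_contra hne
      exact absurd hj (by simpa using h j hne)
    refine hc2 (funext fun l => ?_)
    by_cases hl : l = i
    · rw [hl, ← hjj, hj]; simp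
    · simpa [hl] using h l hl
  set T' := Finset.univ.filter fun l => l ≠ j ∧ c' l = false with hT'
  have hjT' : j ∉ T' := by simp [hT']
  have base := planeSwap_unit hn hji.symm
  have step : PlaneSwap (16 * n + 2 * n) (fun _ => true) (fun l : Fin n => !decide (l = i)) c' := by
    refine PlaneSwap.conj (γ := shear j T') ?_ (realizes_shear hn hjT') (shear_shear hjT')
      (shear_xor3 j T')
    rwa [shear_of_set T' rfl, shear_of_set T' (by simp [hji]), shear_filter hj]
  have := PlaneSwap.conj (a := fun _ => true) (b := b) (c := c) (γ := shear i T)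
    (by rwa [h1, hb']) (realizes_shear hn hiT) (shear_shear hiT) (shear_xor3 i T)
  exact (show 16 * n + 2 * n + 2 * n = 20 * n by ring) ▸ this

theorem realizes_translate {n : ℕ} (hn : 3 ≤ n) (v : Cube n) :
    Realizes n (fun x l => xor (x l) (v l)) := by
  refine ((realizes_fan (fun _ => true) (Finset.univ.filter fun l => v l = true)
    (fun l _ => realizes_gate_const hn l true) fun _ _ _ => rfl).mono
    ((Finset.card_le_univ _).trans_eq (Fintype.card_fin n))).congr fun x => ?_
  funext l
  simp

theorem planeSwap {n : ℕ} (hn : 3 ≤ n) {a b c : Cube n} (hab : a ≠ b) (hca : c ≠ a)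
    (hcb : c ≠ b) : PlaneSwap (22 * n) a b c := by
  set γ : Cube n → Cube n := fun x l => xor (x l) (!a l) with hγ
  have hinv : ∀ x, γ (γ x) = x := fun x => by funext l; simp [hγ]
  have hinj : ∀ x y, γ x = γ y → x = y := fun x y h => by rw [← hinv x, h, hinv]
  have ha : γ a = fun _ => true := by funext l; simp [hγ]
  have := PlaneSwap.conj (a := a) (b := b) (c := c) (γ := γ) (L := 20 * n)
    (by
      rw [ha]
      exact planeSwap_of_fst_true hn (fun h => hab (hinj _ _ (ha.trans h.symm)))
        (fun h => hca (hinj _ _ (h.trans ha.symm))) fun h => hcb (hinj _ _ h))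
    (realizes_translate hn _) hinv (fun x y z => by
      funext l
      simp only [hγ, xor3]
      cases a l <;> cases x l <;> cases y l <;> cases z l <;> rfl)
  exact (show 20 * n + 2 * n = 22 * n by ring) ▸ this

/-! ### The swap chain and energies along paths. -/

/-- The action of a permutation of `α` on the tuples of distinct elements of `α`. -/
def tupleEquiv {ι α : Type*} (g : Equiv.Perm α) : (ι ↪ α) ≃ (ι ↪ α) where
  toFun x := x.trans g.toEmbedding
  invFun x := x.trans g.symm.toEmbedding
  left_inv x := by ext r; simp
  right_inv x := by ext r; simp

@[simp]
theorem tupleEquiv_apply {ι α : Type*} (g : Equiv.Perm α) (x : ι ↪ α) (r : ι) :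
    tupleEquiv g x r = g (x r) := rfl

theorem tupleEquiv_mul {ι α : Type*} (g g' : Equiv.Perm α) (x : ι ↪ α) :
    tupleEquiv (g * g') x = tupleEquiv g (tupleEquiv g' x) := rfl

theorem tupleEquiv_pretransitive {ι α : Type*} [Finite ι] [Finite α] (x y : ι ↪ α) :
    ∃ g : Equiv.Perm α, tupleEquiv g x = y := by
  classical
  have := Fintype.ofFinite α
  let e : {a // a ∈ Set.range x} ≃ {a // a ∈ Set.range y} :=
    (Equiv.ofInjective x x.injective).symm.trans (Equiv.ofInjective y y.injective)
  refine ⟨e.extendSubtype, ?_⟩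
  ext r
  have h : e ⟨x r, r, rfl⟩ = ⟨y r, r, rfl⟩ := by
    have : (⟨x r, r, rfl⟩ : {a // a ∈ Set.range x}) = Equiv.ofInjective x x.injective r := rfl
    simp only [e, Equiv.trans_apply, this, Equiv.symm_apply_apply]
    rfl
  rw [tupleEquiv_apply, e.extendSubtype_apply_of_mem _ ⟨r, rfl⟩, h]

/-- Exchange the values `x r` and `c`. -/
def swapMove {ι α : Type*} [DecidableEq α] (x : ι ↪ α) (r : ι) (c : α) : ι ↪ α :=
  tupleEquiv (Equiv.swap (x r) c) x

theorem swapMove_tupleEquiv {ι α : Type*} [DecidableEq α] (g : Equiv.Perm α) (x : ι ↪ α) (r : ι)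
    (c : α) : swapMove (tupleEquiv g x) r (g c) = tupleEquiv g (swapMove x r c) := by
  ext t
  simp [swapMove, Equiv.swap_apply_apply]

/-- The (unnormalized) Dirichlet form of the chain which replaces an entry of a tuple by an
arbitrary value, an entry with this value being replaced in return. -/
noncomputable def swapEnergy {ι α : Type*} [Fintype ι] [Fintype α] [DecidableEq ι] [DecidableEq α]
    (f : (ι ↪ α) → ℝ) : ℝ :=
  ∑ x : ι ↪ α, ∑ r, ∑ c, (f (swapMove x r c) - f x) ^ 2

/-- Relabelling values commutes with swap moves, so averaging over symmetries of the cube leaves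
this side of the comparison unchanged. -/
theorem swapEnergy_comp_tupleEquiv {ι α : Type*} [Fintype ι] [Fintype α] [DecidableEq ι]
    [DecidableEq α] (f : (ι ↪ α) → ℝ) (g : Equiv.Perm α) :
    swapEnergy (fun x => f (tupleEquiv g x)) = swapEnergy f := by
  unfold swapEnergy
  symm
  rw [← Equiv.sum_comp (tupleEquiv g)]
  refine Finset.sum_congr rfl fun x _ => Finset.sum_congr rfl fun r _ => ?_
  rw [← Equiv.sum_comp g]
  simp only [swapMove_tupleEquiv]

/-- The energy of `f` along the path which starts at `x` and follows the word `w`. -/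
def pathEnergy {n k : ℕ} (f : DistinctTuple n k → ℝ) :
    List (SimpleLabel 2 n) → DistinctTuple n k → ℝ
  | [], _ => 0
  | s :: w, x => (f (simpleAct s x) - f x) ^ 2 + pathEnergy f w (simpleAct s x)

theorem pathEnergy_nonneg {n k : ℕ} (f : DistinctTuple n k → ℝ) (w : List (SimpleLabel 2 n))
    (x : DistinctTuple n k) : 0 ≤ pathEnergy f w x := by
  induction w generalizing x with
  | nil => exact le_rfl
  | cons s w ih => exact add_nonneg (sq_nonneg _) (ih _)

/-- Cauchy–Schwarz for the telescoping sum along the path. -/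
theorem sq_sub_le_pathEnergy {n k : ℕ} (f : DistinctTuple n k → ℝ) (w : List (SimpleLabel 2 n))
    (x y : DistinctTuple n k) (hy : ∀ r, y r = wordAct w (x r)) :
    (f y - f x) ^ 2 ≤ w.length * pathEnergy f w x := by
  induction w generalizing x with
  | nil =>
    have : y = x := by ext1 r; exact hy r
    simp [this, pathEnergy]
  | cons s w ih =>
    have := ih (simpleAct s x) hy
    have hE := pathEnergy_nonneg f w (simpleAct s x)
    simp only [pathEnergy, List.length_cons, Nat.cast_add, Nat.cast_one]
    set E := pathEnergy f w (simpleAct s x)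
    set m : ℝ := (w.length : ℝ) with hm
    have hm0 : 0 ≤ m := by positivity
    set A := f (simpleAct s x) - f x with hA
    set B := f y - f (simpleAct s x)
    have hAB : f y - f x = A + B := by ring
    rw [hAB]
    rcases hm0.eq_or_lt with h0 | hpos
    · have hB : B = 0 := by
        rw [← h0, zero_mul] at this
        exact pow_eq_zero_iff two_ne_zero |>.1 (le_antisymm this (sq_nonneg _))
      rw [← h0, hB]; nlinarith
    · have h1 : 2 * A * B ≤ m * A ^ 2 + E := by
        have : B ^ 2 / m ≤ E := by rw [div_le_iff₀ hpos]; linarith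
        have h2 : 0 ≤ (m * A - B) ^ 2 / m := by positivity
        have h3 : (m * A - B) ^ 2 / m = m * A ^ 2 - 2 * A * B + B ^ 2 / m := by
          field_simp; ring
        linarith
      nlinarith

/-! ### Symmetries of the cube and averaged congestion. -/

/-- The symmetry of the cube which permutes the coordinates by `σ` and then adds `v`. -/
def cubeSymm {n : ℕ} (σ : Equiv.Perm (Fin n)) (v : Cube n) : Equiv.Perm (Cube n) where
  toFun p l := xor (p (σ.symm l)) (v l)
  invFun q l := xor (q (σ l)) (v (σ l))
  left_inv p := by funext l; simp
  right_inv q := by funext l; simp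

theorem cubeSymm_apply {n : ℕ} (σ : Equiv.Perm (Fin n)) (v p : Cube n) (l : Fin n) :
    cubeSymm σ v p l = xor (p (σ.symm l)) (v l) := rfl

/-- The wires of a gate: a target and two distinct inputs. -/
abbrev Wires (n : ℕ) : Type := Σ i : Fin n, (Fin 2 ↪ {j : Fin n // j ≠ i})

/-- Permuting the wires of a gate. -/
def permWires {n : ℕ} (σ : Equiv.Perm (Fin n)) (p : Wires n) : Wires n :=
  ⟨σ p.1, ⟨fun t => ⟨σ (p.2 t), σ.injective.ne (p.2 t).2⟩, fun _ _ h =>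
    p.2.injective (Subtype.ext (σ.injective (Subtype.ext_iff.1 h)))⟩⟩

theorem permWires_mul {n : ℕ} (σ τ : Equiv.Perm (Fin n)) (p : Wires n) :
    permWires (σ * τ) p = permWires σ (permWires τ p) := rfl

theorem permWires_one {n : ℕ} (p : Wires n) : permWires 1 p = p := rfl

theorem permWires_pretransitive {n : ℕ} (p q : Wires n) : ∃ σ, permWires σ p = q := by
  have emb : ∀ p : Wires n, Function.Injective (![p.1, p.2 0, p.2 1] : Fin 3 → Fin n) := by
    intro p a b hab
    have h0 := (p.2 0).2
    have h1 := (p.2 1).2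
    have h01 : ((p.2 0 : Fin n)) ≠ p.2 1 := fun h => by
      have := p.2.injective (Subtype.ext h)
      exact absurd this (by decide)
    fin_cases a <;> fin_cases b <;> first | rfl | (simp at hab; simp_all)
  obtain ⟨σ, hσ⟩ := tupleEquiv_pretransitive ⟨_, emb p⟩ ⟨_, emb q⟩
  have h0 : σ p.1 = q.1 := DFunLike.congr_fun hσ 0
  have h1 : σ (p.2 0) = q.2 0 := DFunLike.congr_fun hσ 1
  have h2 : σ (p.2 1) = q.2 1 := DFunLike.congr_fun hσ 2
  refine ⟨σ, ?_⟩
  obtain ⟨i, J⟩ := q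
  simp only at h0 h1 h2
  subst h0
  unfold permWires
  congr 1
  ext t
  fin_cases t
  · exact congrArg Fin.val h1
  · exact congrArg Fin.val h2

/-- The action on wires is transitive, so an average over the group is a uniform average over wires.
-/
theorem sum_permWires {n : ℕ} (φ : Wires n → ℝ) (p : Wires n) :
    (Fintype.card (Wires n) : ℝ) * ∑ σ, φ (permWires σ p) = (n.factorial : ℝ) * ∑ q, φ q := by
  have h1 : ∀ q, ∑ σ, φ (permWires σ q) = ∑ σ, φ (permWires σ p) := fun q => by
    obtain ⟨τ, rfl⟩ := permWires_pretransitive p q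
    simp only [← permWires_mul]
    exact Equiv.sum_comp (Equiv.mulRight τ) fun σ => φ (permWires σ p)
  have h2 : ∀ σ : Equiv.Perm (Fin n), ∑ q, φ (permWires σ q) = ∑ q, φ q := fun σ => by
    let e : Wires n ≃ Wires n := ⟨permWires σ, permWires σ⁻¹,
      fun q => by rw [← permWires_mul, inv_mul_cancel, permWires_one],
      fun q => by rw [← permWires_mul, mul_inv_cancel, permWires_one]⟩
    exact Equiv.sum_comp e φ
  have h3 : ∑ q, ∑ σ, φ (permWires σ q) = ∑ σ : Equiv.Perm (Fin n), ∑ q, φ (permWires σ q) :=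
    Finset.sum_comm
  simp only [h1, h2, Finset.sum_const, Finset.card_univ, nsmul_eq_mul, Fintype.card_perm,
    Fintype.card_fin] at h3
  exact h3

/-- The permutation moves the wires; a translation commutes with adding to the target, and its
effect on the inputs is absorbed into the Boolean function. -/
theorem cubeSymm_simpleFun {n : ℕ} (σ : Equiv.Perm (Fin n)) (v : Cube n) (s : SimpleLabel 2 n) :
    ∃ h, ∀ p, cubeSymm σ v (simpleFun s p) =
      simpleFun ⟨(permWires σ ⟨s.1, s.2.1⟩).1, (permWires σ ⟨s.1, s.2.1⟩).2, h⟩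
        (cubeSymm σ v p) := by
  refine ⟨fun y => s.2.2 fun t => xor (y t) (v (σ (s.2.1 t))), fun p => ?_⟩
  funext l
  by_cases hl : l = σ s.1
  · subst hl
    simp only [cubeSymm_apply, simpleFun, permWires, Equiv.symm_apply_apply, Function.update_self,
      Bool.xor_assoc]
    rw [Bool.xor_comm (v _)]
    congr 2
    refine congrArg s.2.2 (funext fun t => ?_)
    change _ = xor (p (σ.symm (σ (s.2.1 t)))) (xor (v (σ (s.2.1 t))) (v (σ (s.2.1 t))))
    simp
  · have hl' : σ.symm l ≠ s.1 := fun h => hl (by rw [← h]; simp)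
    simp [cubeSymm_apply, simpleFun, permWires, hl, hl']

/-- Each tuple `u` arises exactly once, since `u r` and the image of `a` determine `v`. Pinning one
entry thus compensates exactly for the sum over translations. -/
theorem sum_tupleEquiv_cubeSymm {n k : ℕ} (Φ : DistinctTuple n k → ℝ) (σ : Equiv.Perm (Fin n))
    (r : Fin k) (a : Cube n) :
    ∑ v, ∑ x : DistinctTuple n k with x r = a, Φ (tupleEquiv (cubeSymm σ v) x) = ∑ u, Φ u := by
  have h1 : ∀ v, ∑ x : DistinctTuple n k with x r = a, Φ (tupleEquiv (cubeSymm σ v) x) =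
      ∑ u : DistinctTuple n k, if u r = cubeSymm σ v a then Φ u else 0 := fun v => by
    symm
    rw [Finset.sum_filter, ← Equiv.sum_comp (tupleEquiv (cubeSymm σ v))]
    simp
  simp only [h1]
  rw [Finset.sum_comm]
  refine Finset.sum_congr rfl fun u _ => ?_
  have h2 : ∀ v, u r = cubeSymm σ v a ↔ v = fun l => xor (u r l) (a (σ.symm l)) := fun v => by
    simp only [funext_iff, cubeSymm_apply]
    refine forall_congr' fun l => ?_
    cases u r l <;> cases a (σ.symm l) <;> cases v l <;> simp
  simp [h2]

/-- The (unnormalized) Dirichlet form of the walk by simple permutations. -/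
noncomputable def simpleEnergy {n k : ℕ} (f : DistinctTuple n k → ℝ) : ℝ :=
  ∑ s : SimpleLabel 2 n, ∑ x, (f (simpleAct s x) - f x) ^ 2

theorem sum_simpleLabel {n : ℕ} (φ : SimpleLabel 2 n → ℝ) :
    ∑ s, φ s = ∑ p : Wires n, ∑ h, φ ⟨p.1, p.2, h⟩ := by
  rw [Fintype.sum_sigma, Fintype.sum_sigma]
  refine Finset.sum_congr rfl fun i _ => ?_
  rw [Fintype.sum_prod_type]

theorem card_simpleLabel (n : ℕ) :
    Fintype.card (SimpleLabel 2 n) = 16 * Fintype.card (Wires n) := by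
  have := sum_simpleLabel (n := n) fun _ => 1
  have h16 : Fintype.card ((Fin 2 → Bool) → Bool) = 16 := by simp
  simp only [Finset.sum_const, Finset.card_univ, nsmul_eq_mul, mul_one, h16] at this
  rw [mul_comm]
  exact_mod_cast this

/-- Averaging spreads a fixed step evenly over wires and tuples. The conjugated Boolean function
varies with `v`, so its term is bounded by the sum over all sixteen functions. -/
theorem sum_symm_step_le {n k : ℕ} (f : DistinctTuple n k → ℝ) (s : SimpleLabel 2 n) (r : Fin k)
    (a : Cube n) :
    (Fintype.card (Wires n) : ℝ) * ∑ σ, ∑ v, ∑ x : DistinctTuple n k with x r = a,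
      (f (tupleEquiv (cubeSymm σ v) (simpleAct s x)) - f (tupleEquiv (cubeSymm σ v) x)) ^ 2 ≤
    (n.factorial : ℝ) * simpleEnergy f := by
  let Φ : Wires n → DistinctTuple n k → ℝ := fun p u =>
    ∑ h, (f (simpleAct (⟨p.1, p.2, h⟩ : SimpleLabel 2 n) u) - f u) ^ 2
  have hΦ : simpleEnergy f = ∑ p, ∑ u, Φ p u := by
    rw [simpleEnergy, sum_simpleLabel]
    exact Finset.sum_congr rfl fun p _ => Finset.sum_comm
  rw [hΦ, ← sum_permWires (fun p => ∑ u, Φ p u) ⟨s.1, s.2.1⟩]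
  gcongr with σ
  rw [← sum_tupleEquiv_cubeSymm _ σ r a]
  gcongr with v _ x
  obtain ⟨h, hh⟩ := cubeSymm_simpleFun σ v s
  have e : tupleEquiv (cubeSymm σ v) (simpleAct s x) =
      simpleAct (⟨(permWires σ ⟨s.1, s.2.1⟩).1, (permWires σ ⟨s.1, s.2.1⟩).2, h⟩ : SimpleLabel 2 n)
        (tupleEquiv (cubeSymm σ v) x) := by
    ext1 t
    exact hh (x t)
  rw [e]
  exact Finset.single_le_sum (f := fun h => (f (simpleAct (⟨(permWires σ ⟨s.1, s.2.1⟩).1,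
    (permWires σ ⟨s.1, s.2.1⟩).2, h⟩ : SimpleLabel 2 n) (tupleEquiv (cubeSymm σ v) x)) -
      f (tupleEquiv (cubeSymm σ v) x)) ^ 2) (fun _ _ => sq_nonneg _) (Finset.mem_univ h)

theorem sum_symm_pathEnergy_le {n k : ℕ} (f : DistinctTuple n k → ℝ) (w : List (SimpleLabel 2 n))
    (r : Fin k) (a : Cube n) :
    (Fintype.card (Wires n) : ℝ) * ∑ σ, ∑ v, ∑ x : DistinctTuple n k with x r = a,
      pathEnergy (fun y => f (tupleEquiv (cubeSymm σ v) y)) w x ≤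
    w.length * ((n.factorial : ℝ) * simpleEnergy f) := by
  -- The pinned value moves along the word, hence the generalization.
  induction w generalizing a with
  | nil => simp [pathEnergy]
  | cons s w ih =>
    have h1 := sum_symm_step_le f s r a
    have h2 := ih (simpleFun s a)
    have h3 : ∀ F : DistinctTuple n k → ℝ, ∑ x : DistinctTuple n k with x r = a,
        F (simpleAct s x) = ∑ x : DistinctTuple n k with x r = simpleFun s a, F x := fun F => by
      symm
      rw [Finset.sum_filter, Finset.sum_filter,
        ← Equiv.sum_comp (simpleAct_involutive (k := k) s).toPerm]
      refine Finset.sum_congr rfl fun x _ => ?_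
      have : simpleAct s x r = simpleFun s a ↔ x r = a :=
        (simpleFun_involutive s).injective.eq_iff
      simp [this]
    simp only [pathEnergy, Finset.sum_add_distrib, mul_add, List.length_cons, Nat.cast_add,
      Nat.cast_one, add_mul, one_mul, h3]
    linarith

/-! ### Comparison of the two Dirichlet forms. -/

theorem xor3_xor3 {n : ℕ} (a b c : Cube n) : xor3 a b (xor3 a b c) = c := by
  funext l
  simp only [xor3]
  cases a l <;> cases b l <;> cases c l <;> rfl

/-- Since `xor3 a b` is an involution, each entry of `x` excludes at most two values of `c`. -/
theorem card_avoiding {n k : ℕ} (x : DistinctTuple n k) (a b : Cube n) :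
    (2 : ℝ) ^ n - 2 * k ≤
      (Finset.univ.filter fun c => c ∉ Set.range x ∧ xor3 a b c ∉ Set.range x).card := by
  classical
  have h1 : (Finset.univ.filter fun c => c ∉ Set.range x ∧ xor3 a b c ∉ Set.range x)ᶜ ⊆
      Finset.univ.image x ∪ Finset.univ.image (fun r => xor3 a b (x r)) := by
    intro c hc
    simp only [Finset.mem_compl, Finset.mem_filter, Finset.mem_univ, true_and, not_and_or,
      not_not, Set.mem_range] at hc
    simp only [Finset.mem_union, Finset.mem_image, Finset.mem_univ, true_and]
    refine hc.imp id fun ⟨r, hr⟩ => ⟨r, by rw [hr, xor3_xor3]⟩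
  have h2 := Finset.card_le_card h1
  have h3 : (Finset.univ.image x ∪ Finset.univ.image (fun r => xor3 a b (x r))).card ≤ k + k :=
    (Finset.card_union_le _ _).trans (add_le_add
      (Finset.card_image_le.trans_eq (by simp)) (Finset.card_image_le.trans_eq (by simp)))
  rw [Finset.card_compl, Fintype.card_fun, Fintype.card_bool, Fintype.card_fin] at h2
  have h4 : 2 ^ n ≤ (Finset.univ.filter fun c => c ∉ Set.range x ∧
      xor3 a b c ∉ Set.range x).card + 2 * k := by omega
  have : ((2 ^ n : ℕ) : ℝ) ≤ (((Finset.univ.filter fun c => c ∉ Set.range x ∧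
      xor3 a b c ∉ Set.range x).card + 2 * k : ℕ) : ℝ) := by exact_mod_cast h4
  push_cast at this
  linarith

theorem sum_comm_four {A B C D E : Type*} [Fintype A] [Fintype B] [Fintype C] [Fintype D]
    [Fintype E] (Q : A → B → C → D → E → ℝ) :
    ∑ a, ∑ b, ∑ c, ∑ d, ∑ e, Q a b c d e = ∑ b, ∑ c, ∑ d, ∑ e, ∑ a, Q a b c d e := by
  rw [Finset.sum_comm]
  refine Finset.sum_congr rfl fun b _ => ?_
  rw [Finset.sum_comm]
  refine Finset.sum_congr rfl fun c _ => ?_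
  rw [Finset.sum_comm]
  exact Finset.sum_congr rfl fun d _ => Finset.sum_comm

/-- If all plane swaps are realized by words of length at most `L`, then the Dirichlet form of the
swap chain is bounded by that of the walk by simple permutations. -/
theorem swapEnergy_le_simpleEnergy {n k L : ℕ}
    (hL : ∀ a b c : Cube n, a ≠ b → c ≠ a → c ≠ b → PlaneSwap L a b c)
    (f : DistinctTuple n k → ℝ) :
    ((2 : ℝ) ^ n - 2 * k) * (Fintype.card (Wires n) * swapEnergy f) ≤
      (L : ℝ) ^ 2 * k * (2 ^ n) ^ 2 * simpleEnergy f := by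
  have hL' : ∀ a b c : Cube n, ∃ w : List (SimpleLabel 2 n), w.length ≤ L ∧
      (a ≠ b → c ≠ a → c ≠ b → wordAct w a = b ∧ wordAct w b = a ∧
        ∀ p, p ≠ a → p ≠ b → p ≠ c → p ≠ xor3 a b c → wordAct w p = p) := fun a b c => by
    by_cases h : a ≠ b ∧ c ≠ a ∧ c ≠ b
    · obtain ⟨w, hw, h⟩ := hL a b c h.1 h.2.1 h.2.2
      exact ⟨w, hw, fun _ _ _ => h⟩
    · exact ⟨[], Nat.zero_le _, fun h1 h2 h3 => absurd ⟨h1, h2, h3⟩ h⟩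
  choose w hw hw' using hL'
  have point : ∀ (f : DistinctTuple n k → ℝ) x r b, ((2 : ℝ) ^ n - 2 * k) *
      (f (swapMove x r b) - f x) ^ 2 ≤ L * ∑ c, pathEnergy f (w (x r) b c) x := by
    intro f x r b
    have hnn : 0 ≤ L * ∑ c, pathEnergy f (w (x r) b c) x :=
      mul_nonneg (Nat.cast_nonneg _) (Finset.sum_nonneg fun c _ => pathEnergy_nonneg _ _ _)
    by_cases hb : x r = b
    · have : swapMove x r b = x := by ext1 t; simp [swapMove, hb]
      rw [this]; simpa using hnn
    · set G := Finset.univ.filter fun c => c ∉ Set.range x ∧ xor3 (x r) b c ∉ Set.range x with hG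
      have h1 : ∀ c ∈ G, (f (swapMove x r b) - f x) ^ 2 ≤ L * pathEnergy f (w (x r) b c) x := by
        intro c hc
        simp only [hG, Finset.mem_filter, Finset.mem_univ, true_and] at hc
        have hcx : ∀ t, x t ≠ c := fun t h => hc.1 ⟨t, h⟩
        have hdx : ∀ t, x t ≠ xor3 (x r) b c := fun t h => hc.2 ⟨t, h⟩
        have hcb : c ≠ b := fun h => hdx r (by funext l; simp [xor3, h])
        obtain ⟨e1, e2, e3⟩ := hw' (x r) b c hb (hcx r).symm hcb
        refine (sq_sub_le_pathEnergy f (w (x r) b c) x _ fun t => ?_).trans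
          (mul_le_mul_of_nonneg_right (by exact_mod_cast hw _ _ _) (pathEnergy_nonneg _ _ _))
        rw [swapMove, tupleEquiv_apply]
        by_cases ht : x t = x r
        · rw [ht, e1, Equiv.swap_apply_left]
        · by_cases ht' : x t = b
          · rw [ht', e2, Equiv.swap_apply_right]
          · rw [e3 _ ht ht' (hcx t) (hdx t), Equiv.swap_apply_of_ne_of_ne ht ht']
      calc _ ≤ (G.card : ℝ) * (f (swapMove x r b) - f x) ^ 2 :=
            mul_le_mul_of_nonneg_right (card_avoiding x (x r) b) (sq_nonneg _)
        _ = ∑ c ∈ G, (f (swapMove x r b) - f x) ^ 2 := by simp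
        _ ≤ ∑ c ∈ G, L * pathEnergy f (w (x r) b c) x := Finset.sum_le_sum h1
        _ ≤ ∑ c, L * pathEnergy f (w (x r) b c) x :=
            Finset.sum_le_sum_of_subset_of_nonneg (Finset.subset_univ _) fun c _ _ =>
              mul_nonneg (Nat.cast_nonneg _) (pathEnergy_nonneg _ _ _)
        _ = _ := by rw [Finset.mul_sum]
  -- The word depends on `x` only through `x r`; grouping tuples by this value fixes the word, as
  -- the averaged bound requires.
  have total : ∀ f : DistinctTuple n k → ℝ, ((2 : ℝ) ^ n - 2 * k) * swapEnergy f ≤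
      L * ∑ r, ∑ b, ∑ c, ∑ a, ∑ x : DistinctTuple n k with x r = a,
        pathEnergy f (w a b c) x := by
    intro f
    have e : ∀ r b c, ∑ a, ∑ x : DistinctTuple n k with x r = a, pathEnergy f (w a b c) x =
        ∑ x : DistinctTuple n k, pathEnergy f (w (x r) b c) x := fun r b c => by
      rw [← Finset.sum_fiberwise (s := Finset.univ) (g := fun x : DistinctTuple n k => x r)]
      refine Finset.sum_congr rfl fun a _ => Finset.sum_congr rfl fun x hx => ?_
      rw [(Finset.mem_filter.1 hx).2]
    simp only [e]
    have e2 : ∑ r : Fin k, ∑ b : Cube n, ∑ c : Cube n, ∑ x : DistinctTuple n k,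
        pathEnergy f (w (x r) b c) x =
        ∑ x : DistinctTuple n k, ∑ r, ∑ b, ∑ c, pathEnergy f (w (x r) b c) x := by
      symm
      rw [Finset.sum_comm]
      refine Finset.sum_congr rfl fun r _ => ?_
      rw [Finset.sum_comm]
      refine Finset.sum_congr rfl fun b _ => Finset.sum_comm
    rw [e2, swapEnergy]
    simp only [Finset.mul_sum]
    refine Finset.sum_le_sum fun x _ => Finset.sum_le_sum fun r _ => Finset.sum_le_sum fun b _ => ?_
    rw [← Finset.mul_sum]
    exact point f x r b
  have hN : Fintype.card (Cube n) = 2 ^ n := by simp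
  set T : ℝ := (Fintype.card (Wires n) : ℝ) with hT
  have hT0 : 0 ≤ T := Nat.cast_nonneg _
  have hE : 0 ≤ simpleEnergy f := Finset.sum_nonneg fun _ _ => Finset.sum_nonneg fun _ _ =>
    sq_nonneg _
  have avg : (n.factorial : ℝ) * 2 ^ n * (((2 : ℝ) ^ n - 2 * k) * swapEnergy f) * T ≤
      L * (k * (2 ^ n) ^ 3 * (L * (n.factorial * simpleEnergy f))) := by
    calc (n.factorial : ℝ) * 2 ^ n * (((2 : ℝ) ^ n - 2 * k) * swapEnergy f) * T
        = T * ∑ σ : Equiv.Perm (Fin n), ∑ v : Cube n, ((2 : ℝ) ^ n - 2 * k) *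
            swapEnergy (fun x => f (tupleEquiv (cubeSymm σ v) x)) := by
          simp only [swapEnergy_comp_tupleEquiv, Finset.sum_const, Finset.card_univ, nsmul_eq_mul,
            Fintype.card_perm, Fintype.card_fin, hN]
          push_cast
          ring
      _ ≤ T * ∑ σ : Equiv.Perm (Fin n), ∑ v : Cube n, L * ∑ r, ∑ b, ∑ c, ∑ a,
            ∑ x : DistinctTuple n k with x r = a,
              pathEnergy (fun y => f (tupleEquiv (cubeSymm σ v) y)) (w a b c) x := by
          exact mul_le_mul_of_nonneg_left
            (Finset.sum_le_sum fun σ _ => Finset.sum_le_sum fun v _ => total _) hT0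
      _ = L * ∑ r : Fin k, ∑ b, ∑ c, ∑ a, (T * ∑ σ : Equiv.Perm (Fin n), ∑ v : Cube n,
            ∑ x : DistinctTuple n k with x r = a,
              pathEnergy (fun y => f (tupleEquiv (cubeSymm σ v) y)) (w a b c) x) := by
          simp only [← Finset.mul_sum]
          rw [mul_left_comm]
          congr 2
          refine (Finset.sum_congr rfl fun σ _ => sum_comm_four _).trans ?_
          exact sum_comm_four _
      _ ≤ L * ∑ r : Fin k, ∑ b : Cube n, ∑ c : Cube n, ∑ a : Cube n,
            (L * (n.factorial * simpleEnergy f)) := by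
          refine mul_le_mul_of_nonneg_left (Finset.sum_le_sum fun r _ => Finset.sum_le_sum
            fun b _ => Finset.sum_le_sum fun c _ => Finset.sum_le_sum fun a _ =>
              (sum_symm_pathEnergy_le f (w a b c) r a).trans ?_) (Nat.cast_nonneg _)
          exact mul_le_mul_of_nonneg_right (by exact_mod_cast hw a b c) (by positivity)
      _ = _ := by
          simp only [Finset.sum_const, Finset.card_univ, nsmul_eq_mul, Fintype.card_fin, hN]
          push_cast
          ring
  have hpos : 0 < (n.factorial : ℝ) * 2 ^ n := by
    have := n.factorial_pos
    positivity
  refine le_of_mul_le_mul_left ?_ hpos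
  calc _ = (n.factorial : ℝ) * 2 ^ n * (((2 : ℝ) ^ n - 2 * k) * swapEnergy f) * T := by ring
    _ ≤ _ := avg
    _ = _ := by ring

/-! ### Spectral gaps and quadratic forms. -/

/-- An orthonormal eigenbasis of a real symmetric matrix, in terms of dot products. -/
theorem exists_eigenbasis {V : Type*} [Fintype V] [DecidableEq V] {A : Matrix V V ℝ}
    (hA : A.IsHermitian) : ∃ b : V → V → ℝ,
      (∀ i, A.mulVec (b i) = hA.eigenvalues i • b i) ∧
      (∀ i j, b i ⬝ᵥ b j = if i = j then 1 else 0) ∧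
      ∀ f g : V → ℝ, ∑ i, (f ⬝ᵥ b i) * (b i ⬝ᵥ g) = f ⬝ᵥ g := by
  have key : ∀ f g : EuclideanSpace ℝ V, inner ℝ f g = f.ofLp ⬝ᵥ g.ofLp := fun f g => by
    rw [EuclideanSpace.inner_eq_star_dotProduct, star_trivial, dotProduct_comm]
  refine ⟨fun i => (hA.eigenvectorBasis i).ofLp, fun i => hA.mulVec_eigenvectorBasis i,
    fun i j => ?_, fun f g => ?_⟩
  · rw [← key]
    exact orthonormal_iff_ite.1 hA.eigenvectorBasis.orthonormal i j
  · have := hA.eigenvectorBasis.sum_inner_mul_inner (WithLp.toLp 2 f) (WithLp.toLp 2 g)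
    simpa only [key] using this

theorem dotProduct_mulVec_comm {V : Type*} [Fintype V] {A : Matrix V V ℝ} (hA : A.IsHermitian)
    (f g : V → ℝ) : f ⬝ᵥ A.mulVec g = A.mulVec f ⬝ᵥ g := by
  rw [Matrix.dotProduct_mulVec, ← Matrix.mulVec_transpose]
  congr 2

/-- If `κ` bounds the eigenvalues of all nonconstant eigenvectors, it bounds the quadratic form on
the vectors which sum to zero. -/
theorem mul_dotProduct_le_of_eigenvalue {V : Type*} [Fintype V] [DecidableEq V]
    {A : Matrix V V ℝ} (hA : A.IsHermitian) {κ : ℝ}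
    (h : ∀ (μ : ℝ) (f : V → ℝ), A.mulVec f = μ • f → (∃ x y, f x ≠ f y) → κ ≤ μ)
    {f : V → ℝ} (hf : ∑ x, f x = 0) : κ * (f ⬝ᵥ f) ≤ f ⬝ᵥ A.mulVec f := by
  obtain ⟨b, h1, -, h3⟩ := exists_eigenbasis hA
  rw [← h3 f f, ← h3 f (A.mulVec f), Finset.mul_sum]
  refine Finset.sum_le_sum fun i _ => ?_
  have e : b i ⬝ᵥ A.mulVec f = hA.eigenvalues i * (b i ⬝ᵥ f) := by
    rw [dotProduct_mulVec_comm hA, h1, smul_dotProduct, smul_eq_mul]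
  rw [e, dotProduct_comm f (b i)]
  by_cases hc : ∃ x y, b i x ≠ b i y
  · have := h _ _ (h1 i) hc
    nlinarith [mul_self_nonneg (b i ⬝ᵥ f)]
  · push Not at hc
    have h0 : b i ⬝ᵥ f = 0 := by
      rcases isEmpty_or_nonempty V with hV | ⟨⟨x⟩⟩
      · simp [dotProduct]
      · simp only [dotProduct, hc _ x, ← Finset.mul_sum, hf, mul_zero]
    simp [h0]

/-- A Poincaré inequality bounds the spectral gap from below. -/
theorem le_spectralGap {V : Type*} [Fintype V] [DecidableEq V] {A : Matrix V V ℝ}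
    (hA : A.IsHermitian) (hV : 1 < Fintype.card V) {g : ℝ}
    (h : ∀ f : V → ℝ, ∑ x, f x = 0 → g * (f ⬝ᵥ f) ≤ f ⬝ᵥ f - f ⬝ᵥ A.mulVec f) :
    g ≤ spectralGap A hA hV := by
  obtain ⟨b, h1, h2, -⟩ := exists_eigenbasis hA
  let e : Fin (Fintype.card V) ≃ V := Fintype.equivOfCardEq (Fintype.card_fin _)
  have he : ∀ j, hA.eigenvalues (e j) = hA.eigenvalues₀ j := fun j => by
    simp [Matrix.IsHermitian.eigenvalues, e]
  set j₀ : Fin (Fintype.card V) := ⟨0, by omega⟩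
  set j₁ : Fin (Fintype.card V) := ⟨1, hV⟩
  have hle : hA.eigenvalues₀ j₁ ≤ hA.eigenvalues₀ j₀ := hA.eigenvalues₀_antitone (by simp [j₀, j₁])
  have hne : e j₀ ≠ e j₁ := e.injective.ne (by simp [j₀, j₁])
  -- The span of the top two eigenvectors contains a nonzero vector of sum zero, with Rayleigh
  -- quotient at least β₁; the constants need not be identified as the top eigenvector.
  obtain ⟨s, t, hst, h0⟩ : ∃ s t : ℝ, 0 < s ^ 2 + t ^ 2 ∧
      s * ∑ x, b (e j₀) x + t * ∑ x, b (e j₁) x = 0 := by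
    by_cases hz : ∑ x, b (e j₀) x = 0
    · exact ⟨1, 0, by norm_num, by simp [hz]⟩
    · exact ⟨∑ x, b (e j₁) x, -∑ x, b (e j₀) x,
        by have := sq_pos_of_ne_zero hz; nlinarith [sq_nonneg (∑ x, b (e j₁) x)], by ring⟩
  have hf := h (s • b (e j₀) + t • b (e j₁)) (by
    simpa [Finset.sum_add_distrib, Finset.mul_sum] using h0)
  simp only [Matrix.mulVec_add, Matrix.mulVec_smul, h1, add_dotProduct, dotProduct_add,
    smul_dotProduct, dotProduct_smul, h2, hne, hne.symm, if_true, if_false, he, smul_eq_mul] at hf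
  rw [spectralGap]
  change g ≤ 1 - hA.eigenvalues₀ j₁
  by_contra! hlt
  nlinarith [mul_nonneg (sq_nonneg s) (sub_nonneg.2 hle), mul_pos hst (sub_pos.2 hlt)]

/-! ### The Poincaré inequality of the swap chain. -/

/-- The (unnormalized) Laplacian of the swap chain. -/
noncomputable def swapLaplacian (ι α : Type*) [Fintype ι] [Fintype α] [DecidableEq ι]
    [DecidableEq α] : Matrix (ι ↪ α) (ι ↪ α) ℝ :=
  Matrix.of fun x y => ∑ r, ∑ c,
    ((if x = y then 1 else 0) - if swapMove x r c = y then 1 else 0)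

theorem swapMove_apply_self {ι α : Type*} [DecidableEq α]
    (x : ι ↪ α) (r : ι) (c : α) : swapMove x r c r = c := by
  simp [swapMove]

theorem swapMove_swapMove {ι α : Type*} [DecidableEq α]
    (x : ι ↪ α) (r : ι) (c : α) :
    swapMove (swapMove x r c) r (x r) = x := by
  ext t
  simp [swapMove, Equiv.swap_comm c]

theorem swapLaplacian_isHermitian {ι α : Type*} [Fintype ι] [Fintype α] [DecidableEq ι]
    [DecidableEq α] : (swapLaplacian ι α).IsHermitian := by
  refine Matrix.IsHermitian.ext fun x y => ?_
  have h1 : ∀ (x y : ι ↪ α) r, (∑ c, if swapMove x r c = y then (1 : ℝ) else 0) =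
      if swapMove x r (y r) = y then 1 else 0 := fun x y r => by
    refine Finset.sum_eq_single (y r) (fun c _ hc => if_neg fun h => hc ?_) (by simp)
    rw [← h, swapMove_apply_self]
  have h2 : ∀ r, swapMove x r (y r) = y ↔ swapMove y r (x r) = x := fun r =>
    ⟨fun h => by conv_lhs => rw [← h, swapMove_swapMove],
      fun h => by conv_lhs => rw [← h, swapMove_swapMove]⟩
  simp only [swapLaplacian, Matrix.of_apply, Finset.sum_sub_distrib, h1, h2, eq_comm (a := y),
    star_trivial]

theorem swapLaplacian_mulVec {ι α : Type*} [Fintype ι] [Fintype α] [DecidableEq ι]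
    [DecidableEq α] (f : (ι ↪ α) → ℝ) (x : ι ↪ α) :
    (swapLaplacian ι α).mulVec f x = ∑ r, ∑ c, (f x - f (swapMove x r c)) := by
  simp only [Matrix.mulVec, dotProduct, swapLaplacian, Matrix.of_apply, Finset.sum_mul]
  rw [Finset.sum_comm]
  refine Finset.sum_congr rfl fun r _ => ?_
  rw [Finset.sum_comm]
  refine Finset.sum_congr rfl fun c _ => ?_
  simp [sub_mul, Finset.sum_sub_distrib]

theorem swapEnergy_eq {ι α : Type*} [Fintype ι] [Fintype α] [DecidableEq ι]
    [DecidableEq α] (f : (ι ↪ α) → ℝ) :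
    swapEnergy f = 2 * (f ⬝ᵥ (swapLaplacian ι α).mulVec f) := by
  have h : ∀ r, ∑ x : ι ↪ α, ∑ c, f (swapMove x r c) ^ 2 = ∑ x : ι ↪ α, ∑ _c : α, f x ^ 2 :=
    fun r => by
    -- Reversibility: pairing a move with its reverse is an involution on (tuple, new value).
    let e : (ι ↪ α) × α ≃ (ι ↪ α) × α :=
      Function.Involutive.toPerm (fun p => (swapMove p.1 r p.2, p.1 r)) fun p => by
        simp [swapMove_swapMove, swapMove_apply_self]
    rw [← Fintype.sum_prod_type', ← Fintype.sum_prod_type']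
    exact Equiv.sum_comp e fun p => f p.1 ^ 2
  have h' : ∑ x : ι ↪ α, ∑ r, ∑ c, f (swapMove x r c) ^ 2 =
      ∑ x : ι ↪ α, ∑ _r : ι, ∑ _c : α, f x ^ 2 := by
    rw [Finset.sum_comm]
    simp only [h]
    rw [Finset.sum_comm]
  have e : ∀ x r c, (f (swapMove x r c) - f x) ^ 2 =
      2 * (f x * (f x - f (swapMove x r c))) + (f (swapMove x r c) ^ 2 - f x ^ 2) :=
    fun x r c => by ring
  simp only [swapEnergy, dotProduct, swapLaplacian_mulVec, e, Finset.sum_add_distrib,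
    Finset.sum_sub_distrib, h', sub_self, add_zero, ← Finset.mul_sum]

/-- The indicator of the presence of `a` among the entries of `x`. -/
noncomputable def presence {ι α : Type*} (a : α) (x : ι ↪ α) : ℝ :=
  open Classical in if a ∈ Set.range x then 1 else 0

theorem presence_tupleEquiv {ι α : Type*}
    (a : α) (g : Equiv.Perm α) (x : ι ↪ α) :
    presence a (tupleEquiv g x) = presence (g.symm a) x := by
  have h : a ∈ Set.range (tupleEquiv g x) ↔ g.symm a ∈ Set.range x :=
    exists_congr fun r => g.eq_symm_apply.symm
  by_cases h' : g.symm a ∈ Set.range x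
  · rw [presence, presence, if_pos h', if_pos (h.2 h')]
  · rw [presence, presence, if_neg h', if_neg fun e => h' (h.1 e)]

theorem sum_ite_eq_presence {ι α : Type*} [Fintype ι] [DecidableEq α]
    (a : α) (x : ι ↪ α) :
    (∑ r, if x r = a then (1 : ℝ) else 0) = presence a x := by
  by_cases h : a ∈ Set.range x
  · obtain ⟨r, rfl⟩ := h
    rw [Finset.sum_eq_single r (fun t _ ht => if_neg (x.injective.ne ht)) (by simp)]
    simp [presence]
  · have : ∀ r, x r ≠ a := fun r hr => h ⟨r, hr⟩
    simp [presence, this]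

theorem sum_presence {ι α : Type*} [Fintype ι] [Fintype α] [DecidableEq α]
    (x : ι ↪ α) : ∑ a, presence a x = Fintype.card ι := by
  simp only [← sum_ite_eq_presence]
  rw [Finset.sum_comm]
  simp

/-- The drift of the presence of `a` under the swap chain. -/
theorem sum_presence_sub {ι α : Type*} [Fintype ι] [Fintype α] [DecidableEq α]
    (a : α) (x : ι ↪ α) :
    ∑ r, ∑ c, (presence a x - presence a (swapMove x r c)) =
      Fintype.card α * presence a x - Fintype.card ι := by
  have h1 : ∀ r, ∑ c, presence a (swapMove x r c) =
      (Fintype.card α * presence a x + (1 - presence a x)) +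
      (if x r = a then (1 : ℝ) else 0) * (Fintype.card ι - Fintype.card α) := by
    intro r
    simp only [swapMove, presence_tupleEquiv, Equiv.symm_swap]
    by_cases hr : x r = a
    · subst hr
      have : presence (x r) x = 1 := by simp [presence]
      simp [sum_presence, this]
    · have h : ∀ c, presence (Equiv.swap (x r) c a) x =
          presence a x + if c = a then 1 - presence a x else 0 := fun c => by
        by_cases hc : c = a
        · subst hc; simp [presence]
        · rw [Equiv.swap_apply_of_ne_of_ne (Ne.symm hr) (Ne.symm hc)]; simp [hc]
      simp [h, Finset.sum_add_distrib, hr]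
  simp only [Finset.sum_sub_distrib, h1, Finset.sum_add_distrib, ← Finset.sum_mul,
    sum_ite_eq_presence, Finset.sum_const, Finset.card_univ, nsmul_eq_mul]
  have h01 : presence a x = 0 ∨ presence a x = 1 := by
    unfold presence; split_ifs <;> simp
  rcases h01 with h | h <;> rw [h] <;> ring

theorem exists_swap_ne {ι α : Type*} [Finite ι] [Finite α] [DecidableEq α]
    {f : (ι ↪ α) → ℝ} (hf : ∃ x y, f x ≠ f y) :
    ∃ a b x, f (tupleEquiv (Equiv.swap a b) x) ≠ f x := by
  by_contra! h
  obtain ⟨x, y, hxy⟩ := hf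
  obtain ⟨g, rfl⟩ := tupleEquiv_pretransitive x y
  refine hxy (Eq.symm ?_)
  induction g using Equiv.Perm.swap_induction_on with
  | one => rfl
  | swap_mul g a b _ ih =>
    by_cases hg : f x = f (tupleEquiv g x)
    · rw [tupleEquiv_mul, h, hg]
    · exact absurd (ih hg).symm hg

/-- A nonconstant eigenvector of the swap chain contracts in the metric in which exchanging two
values costs the number of those which are present. -/
theorem le_eigenvalue_swapLaplacian {ι α : Type*} [Fintype ι] [Fintype α] [DecidableEq ι]
    [DecidableEq α] {μ : ℝ} {f : (ι ↪ α) → ℝ}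
    (hμ : (swapLaplacian ι α).mulVec f = μ • f) (hf : ∃ x y, f x ≠ f y) :
    (Fintype.card α : ℝ) - 2 * Fintype.card ι ≤ μ := by
  classical
  have h01 : ∀ a (x : ι ↪ α), presence a x = 0 ∨ presence a x = 1 := fun a x => by
    unfold presence; split_ifs <;> simp
  let cnt : α × α × (ι ↪ α) → ℝ := fun p => presence p.1 p.2.2 + presence p.2.1 p.2.2
  let δ : α × α × (ι ↪ α) → ℝ := fun p => f p.2.2 - f (tupleEquiv (Equiv.swap p.1 p.2.1) p.2.2)
  have cnt_nonneg : ∀ p, 0 ≤ cnt p := fun p => by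
    rcases h01 p.1 p.2.2 with h | h <;> rcases h01 p.2.1 p.2.2 with h' | h' <;>
      simp only [cnt, h, h'] <;> norm_num
  have δ_zero : ∀ p, cnt p ≤ 0 → δ p = 0 := fun ⟨a, b, x⟩ hp => by
    have ha : ∀ r, x r ≠ a := fun r hr => by
      have : presence a x = 1 := by simp [presence, ← hr]
      rcases h01 b x with h | h <;> simp only [cnt, h, this] at hp <;> linarith
    have hb : ∀ r, x r ≠ b := fun r hr => by
      have : presence b x = 1 := by simp [presence, ← hr]
      rcases h01 a x with h | h <;> simp only [cnt, h, this] at hp <;> linarith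
    have : tupleEquiv (Equiv.swap a b) x = x := by
      ext r
      exact Equiv.swap_apply_of_ne_of_ne (ha r) (hb r)
    simp [δ, this]
  obtain ⟨p₀, hp₀⟩ : ∃ p, 0 < δ p := by
    obtain ⟨a, b, x, hx⟩ := exists_swap_ne hf
    rcases lt_or_gt_of_ne hx with h | h
    · exact ⟨(a, b, x), sub_pos.2 h⟩
    · refine ⟨(a, b, tupleEquiv (Equiv.swap a b) x), ?_⟩
      simp only [δ]
      rw [← tupleEquiv_mul, Equiv.swap_mul_self]
      exact sub_pos.2 h
  have cnt_pos : ∀ p, 0 < δ p → 0 < cnt p := fun p hp => by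
    by_contra! h
    exact hp.ne' (δ_zero p h)
  -- `W` is the weighted Lipschitz constant of `f`, and `p` attains it.
  obtain ⟨p, hp, hmax⟩ := Finset.exists_max_image (Finset.univ.filter fun p => 0 < cnt p)
    (fun p => δ p / cnt p) ⟨p₀, by simpa using cnt_pos p₀ hp₀⟩
  simp only [Finset.mem_filter, Finset.mem_univ, true_and] at hp hmax
  set W := δ p / cnt p with hW
  have hW0 : 0 < W := (div_pos hp₀ (cnt_pos p₀ hp₀)).trans_le (hmax p₀ (cnt_pos p₀ hp₀))
  have hle : ∀ q, δ q ≤ W * cnt q := fun q => by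
    rcases (cnt_nonneg q).eq_or_lt with h | h
    · rw [δ_zero q h.ge, ← h, mul_zero]
    · exact (div_le_iff₀ h).1 (hmax q h)
  have heq : δ p = W * cnt p := by rw [hW]; field_simp
  obtain ⟨a, b, x⟩ := p
  set τ := Equiv.swap a b with hτ
  have e1 : μ * f x = ∑ r, ∑ c, (f x - f (swapMove x r c)) := by
    rw [← swapLaplacian_mulVec, hμ]; rfl
  -- Reindexing `c` by `τ` couples the chains from `x` and from its image so that they stay related
  -- by `τ`.
  have e2 : μ * f (tupleEquiv τ x) =
      ∑ r, ∑ c, (f (tupleEquiv τ x) - f (tupleEquiv τ (swapMove x r c))) := by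
    have : μ * f (tupleEquiv τ x) = (swapLaplacian ι α).mulVec f (tupleEquiv τ x) := by
      rw [hμ]; rfl
    rw [this, swapLaplacian_mulVec]
    refine Finset.sum_congr rfl fun r _ => ?_
    rw [← Equiv.sum_comp τ]
    simp only [swapMove_tupleEquiv]
  have e3 : μ * δ (a, b, x) = ∑ r, ∑ c, (δ (a, b, x) - δ (a, b, swapMove x r c)) := by
    have : μ * δ (a, b, x) = μ * f x - μ * f (tupleEquiv τ x) := by simp only [δ]; ring
    rw [this, e1, e2]
    simp only [← Finset.sum_sub_distrib]
    refine Finset.sum_congr rfl fun r _ => Finset.sum_congr rfl fun c _ => ?_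
    simp only [δ]; ring
  -- Maximum principle: `δ ≤ W * cnt` everywhere, with equality at the maximizer.
  have e4 : W * ∑ r, ∑ c, (cnt (a, b, x) - cnt (a, b, swapMove x r c)) ≤ μ * δ (a, b, x) := by
    rw [e3, heq]
    simp only [Finset.mul_sum]
    refine Finset.sum_le_sum fun r _ => Finset.sum_le_sum fun c _ => ?_
    have := hle (a, b, swapMove x r c)
    linarith
  have e5 : ∑ r, ∑ c, (cnt (a, b, x) - cnt (a, b, swapMove x r c)) =
      Fintype.card α * cnt (a, b, x) - 2 * Fintype.card ι := by
    have : ∀ r c, cnt (a, b, x) - cnt (a, b, swapMove x r c) =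
        (presence a x - presence a (swapMove x r c)) +
          (presence b x - presence b (swapMove x r c)) := fun r c => by simp only [cnt]; ring
    simp only [this, Finset.sum_add_distrib, sum_presence_sub]
    simp only [cnt]; ring
  -- The drift gives μ ≥ N - 2k / `cnt`, with N and k the cardinalities of `α` and `ι`; the worst
  -- case is `cnt` = 1.
  have hcnt1 : 1 ≤ cnt (a, b, x) := by
    rcases h01 a x with h | h <;> rcases h01 b x with h' | h' <;>
      simp only [cnt, h, h'] at hp ⊢ <;> linarith
  rw [e5, heq] at e4
  have e6 : (Fintype.card α : ℝ) * cnt (a, b, x) - 2 * Fintype.card ι ≤ μ * cnt (a, b, x) := by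
    refine le_of_mul_le_mul_left ?_ hW0
    linarith
  have hk : (0 : ℝ) ≤ Fintype.card ι := Nat.cast_nonneg _
  by_contra! hlt
  nlinarith

/-- The Poincaré inequality of the swap chain. -/
theorem le_swapEnergy {ι α : Type*} [Fintype ι] [Fintype α] [DecidableEq ι]
    [DecidableEq α] {f : (ι ↪ α) → ℝ} (hf : ∑ x, f x = 0) :
    2 * ((Fintype.card α : ℝ) - 2 * Fintype.card ι) * (f ⬝ᵥ f) ≤ swapEnergy f := by
  rw [swapEnergy_eq, mul_assoc]
  exact mul_le_mul_of_nonneg_left (mul_dotProduct_le_of_eigenvalue swapLaplacian_isHermitian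
    (fun _ _ h h' => le_eigenvalue_swapLaplacian h h') hf) zero_le_two

/-! ### The gap of the walk. -/

theorem walkMatrix_mulVec {n k : ℕ} (f : DistinctTuple n k → ℝ) (x : DistinctTuple n k) :
    (walkMatrix n k).mulVec f x =
      (∑ s : SimpleLabel 2 n, f (simpleAct s x)) / Fintype.card (SimpleLabel 2 n) := by
  simp only [Matrix.mulVec, dotProduct, walkMatrix, Matrix.of_apply, div_mul_eq_mul_div,
    ← Finset.sum_div]
  congr 1
  simp only [Finset.card_filter, Nat.cast_sum, Finset.sum_mul]
  rw [Finset.sum_comm]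
  exact Finset.sum_congr rfl fun s _ => by simp

theorem simpleEnergy_eq {n k : ℕ} (hn : 0 < Fintype.card (SimpleLabel 2 n))
    (f : DistinctTuple n k → ℝ) :
    simpleEnergy f = 2 * Fintype.card (SimpleLabel 2 n) *
      (f ⬝ᵥ f - f ⬝ᵥ (walkMatrix n k).mulVec f) := by
  have hS : (Fintype.card (SimpleLabel 2 n) : ℝ) ≠ 0 := by positivity
  have h1 : ∀ s : SimpleLabel 2 n, ∑ x : DistinctTuple n k, f (simpleAct s x) ^ 2 =
      ∑ x, f x ^ 2 := fun s =>
    Equiv.sum_comp (simpleAct_involutive (k := k) s).toPerm fun x => f x ^ 2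
  have h2 : Fintype.card (SimpleLabel 2 n) * (f ⬝ᵥ (walkMatrix n k).mulVec f) =
      ∑ s : SimpleLabel 2 n, ∑ x, f (simpleAct s x) * f x := by
    simp only [dotProduct, walkMatrix_mulVec, Finset.mul_sum]
    rw [Finset.sum_comm]
    refine Finset.sum_congr rfl fun x _ => ?_
    rw [← Finset.sum_mul]
    field_simp
  have h3 : f ⬝ᵥ f = ∑ x, f x ^ 2 := Finset.sum_congr rfl fun x _ => (sq _).symm
  rw [mul_sub, mul_assoc 2 _ (f ⬝ᵥ (walkMatrix n k).mulVec f), h2, h3, simpleEnergy]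
  simp only [sub_sq, Finset.sum_add_distrib, Finset.sum_sub_distrib, h1, mul_assoc,
    ← Finset.mul_sum, Finset.sum_const, Finset.card_univ, nsmul_eq_mul]
  ring

theorem card_wires_pos {n : ℕ} (hn : 3 ≤ n) : 0 < Fintype.card (Wires n) := by
  rw [Fintype.card_pos_iff]
  obtain ⟨w, -, hw⟩ := realizes_gate_const hn ⟨0, by omega⟩ true
  match w with
  | [] =>
    have := congrFun (hw fun _ => false) ⟨0, by omega⟩
    simp [wordAct, flipAt] at this
  | s :: _ => exact ⟨⟨s.1, s.2.1⟩⟩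

theorem le_spectralGap_walkMatrix {n k : ℕ} (hn : 3 ≤ n) (hk : 1 ≤ k)
    (hkn : (k : ℝ) ≤ 2 ^ n / 3) :
    1 / (144 * (22 * n) ^ 2 * k) ≤ spectralGap (walkMatrix n k) (walkMatrix_isHermitian n k)
      (one_lt_card_distinctTuple hn hk hkn) := by
  refine le_spectralGap _ _ fun f hf => ?_
  have hT : (0 : ℝ) < Fintype.card (Wires n) := by exact_mod_cast card_wires_pos hn
  have hS : 0 < Fintype.card (SimpleLabel 2 n) := by
    rw [card_simpleLabel]
    have := card_wires_pos hn
    omega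
  have h1 := swapEnergy_le_simpleEnergy (L := 22 * n) (fun a b c => planeSwap hn) f
  have h2 := le_swapEnergy hf
  rw [simpleEnergy_eq hS, card_simpleLabel] at h1
  simp only [Fintype.card_fun, Fintype.card_bool, Fintype.card_fin] at h2
  push_cast at h1 h2
  set E := f ⬝ᵥ f - f ⬝ᵥ (walkMatrix n k).mulVec f
  set F := f ⬝ᵥ f
  set T : ℝ := (Fintype.card (Wires n) : ℝ)
  set N : ℝ := (2 : ℝ) ^ n
  have hF : 0 ≤ F := Finset.sum_nonneg fun x _ => mul_self_nonneg (f x)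
  have hN : 0 < N := by positivity
  have hk0 : (0 : ℝ) < k := by exact_mod_cast hk
  have hn0 : (0 : ℝ) < n := by exact_mod_cast (by omega : 0 < n)
  have hgap : N / 3 ≤ N - 2 * k := by linarith
  have h3 : (N / 3) * (T * (2 * (N / 3) * F)) ≤ (N - 2 * k) * (T * swapEnergy f) := by
    refine mul_le_mul hgap (mul_le_mul_of_nonneg_left ?_ hT.le) (by positivity) (by linarith)
    refine le_trans ?_ h2
    gcongr
  -- 144 = 32 · 9/2: the factor 2 · 16 comes from `simpleEnergy_eq` and `card_simpleLabel`, and 9/2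
  -- from the left side of `h3`.
  have h4 : (T * N ^ 2) * F ≤ (T * N ^ 2) * (144 * (22 * n) ^ 2 * k * E) := by nlinarith
  have h5 := le_of_mul_le_mul_left h4 (by positivity)
  rw [div_mul_eq_mul_div, one_mul, div_le_iff₀ (by positivity)]
  linarith

theorem lemma11 :
    ∃ C : ℝ, 0 < C ∧ ∀ (n k : ℕ) (hn : 3 ≤ n) (hk : 1 ≤ k) (hkn : (k : ℝ) ≤ 2 ^ n / 3),
      0 < spectralGap (walkMatrix n k) (walkMatrix_isHermitian n k)
          (one_lt_card_distinctTuple hn hk hkn) ∧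
      1 / spectralGap (walkMatrix n k) (walkMatrix_isHermitian n k)
          (one_lt_card_distinctTuple hn hk hkn) ≤ C * ((n : ℝ) ^ 2 * (k : ℝ)) := by
  refine ⟨144 * 22 ^ 2, by norm_num, fun n k hn hk hkn => ?_⟩
  have h := le_spectralGap_walkMatrix hn hk hkn
  have hk0 : (0 : ℝ) < k := by exact_mod_cast hk
  have hn0 : (0 : ℝ) < n := by exact_mod_cast (by omega : 0 < n)
  have hpos : (0 : ℝ) < 1 / (144 * (22 * n) ^ 2 * k) := by positivity
  refine ⟨hpos.trans_le h, (one_div_le_one_div_of_le hpos h).trans_eq ?_⟩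
  rw [one_div_one_div]
  ring
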